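/- Let $\mathbb K$ be a field and $V$ a $\mathbb K$-vector space of finite positive dimension. A subspace $W\neq 0$ of $V$ is an eigenspace of $A\in\mathrm{End}(V)$ if $W=\{v\in V\mid Av=\theta v\}$ for some $\theta\in\mathbb K$ (the associated eigenvalue), and $A$ is diagonalizable if $V$ is spanned by the eigenspaces of $A$. For $A,B\in\mathrm{End}(V)$, an ordering $\{V_i\}_{i=0}^d$ (without repetition) of all the eigenspaces of $A$ is called standard with respect to $B$ if $BV_i\subseteq V_{i-1}+V_i+V_{i+1}$ for $0\le i\le d$, where $V_{-1}=V_{d+1}=0$. A tridiagonal pair on $V$ is a pair $A,A^*\in\mathrm{End}(V)$ of diagonalizable maps such that the eigenspaces of $A$ have an ordering that is standard with respect to $A^*$, the eigenspaces of $A^*$ have an ordering that is standard with respect to $A$, and there is no subspace $W$ of $V$ with $AW\subseteq W$, $A^*W\subseteq W$, $W\ne 0$, $W\ne V$. A tridiagonal system on $V$ is a sequence $\Phi=(A;\{E_i\}_{i=0}^d;A^*;\{E^*_i\}_{i=0}^d)$ of elements of $\mathrm{End}(V)$ such that $A,A^*$ is a tridiagonal pair; for some ordering $\{V_i\}_{i=0}^d$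 of the eigenspaces of $A$ that is standard with respect to $A^*$, each $E_i$ is the identity on $V_i$ and zero on $V_j$ for all $j\neq i$; and likewise $\{E^*_i\}_{i=0}^d$ for $A^*$ with respect to $A$. Let $\Phi$ be a tridiagonal system on $V$, and for $0\le i\le d$ let $\theta_i$ (resp. $\theta^*_i$) be the eigenvalue of $A$ (resp. $A^*$) associated with the eigenspace $E_iV$ (resp. $E^*_iV$). Let $T$ be the unital associative $\mathbb K$-algebra with generators $a,\{e_i\}_{i=0}^d,a^*,\{e^*_i\}_{i=0}^d$ and relations \[ e_ie_j=\delta_{i,j}e_i,\qquad e^*_ie^*_j=\delta_{i,j}e^*_i\qquad(0\le i,j\le d), \] \[ \sum_{i=0}^d e_i=1,\qquad \sum_{i=0}^d e^*_i=1,\qquad a=\sum_{i=0}^d\theta_ie_i,\qquad a^*=\sum_{i=0}^d\theta^*_ie^*_i, \] \[ e^*_ia^ke^*_j=0,\qquad e_i(a^*)^ke_j=0\qquad\text{if } k<|i-j| \qquad (0\le i,j,k\le d). \] Let $D$ be the $\mathbb K$-subalgebra of $T$ generated by $a$. Write $e^*_0De^*_0=\{e^*_0xe^*_0\mid x\in D\}$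 and let $e^*_0Te^*_0=\{e^*_0xe^*_0\mid x\in T\}$, a $\mathbb K$-algebra with identity $e^*_0$. Then: (i) the algebra $e^*_0Te^*_0$ is generated by $e^*_0De^*_0$; (ii) the elements of $e^*_0De^*_0$ mutually commute; (iii) the algebra $e^*_0Te^*_0$ is commutative. -/

import Mathlib

namespace TridiagonalSystems

section Pairs

variable {K V : Type*} [Field K] [AddCommGroup V] [Module K V]

/-- `W` is an eigenspace of `A`: it is nonzero and of the form `{v | A v = θ v}`. -/
def IsEigenspace (A : Module.End K V) (W : Submodule K V) : Prop :=
  W ≠ ⊥ ∧ ∃ θ : K, W = A.eigenspace θ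

/-- `A` is diagonalizable: `V` is spanned by the eigenspaces of `A`. -/
def IsDiagonalizable (A : Module.End K V) : Prop :=
  sSup {W : Submodule K V | IsEigenspace A W} = ⊤

/-- `W 0, …, W d` is an ordering (without repetition) of all the eigenspaces of `A`. -/
def IsEigenspaceOrdering (A : Module.End K V) {d : ℕ} (W : Fin (d + 1) → Submodule K V) : Prop :=
  Function.Injective W ∧ Set.range W = {U : Submodule K V | IsEigenspace A U}

/-- The ordering `W` of the eigenspaces of `A` is standard with respect to `B`:
`B W_i ⊆ W_{i-1} + W_i + W_{i+1}` for `0 ≤ i ≤ d`, where `W_{-1} = W_{d+1} = 0`. -/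
def IsStandardOrdering (A B : Module.End K V) {d : ℕ} (W : Fin (d + 1) → Submodule K V) : Prop :=
  IsEigenspaceOrdering A W ∧
    ∀ i : Fin (d + 1), (W i).map B ≤
      ⨆ j : Fin (d + 1), ⨆ _ : (i : ℕ) ≤ (j : ℕ) + 1 ∧ (j : ℕ) ≤ (i : ℕ) + 1, W j

/-- `A, As` is a tridiagonal pair on `V`. -/
structure IsTridiagonalPair (A As : Module.End K V) : Prop where
  diagonalizable : IsDiagonalizable A
  diagonalizable_dual : IsDiagonalizable As
  exists_standard : ∃ (d : ℕ) (W : Fin (d + 1) → Submodule K V), IsStandardOrdering A As W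
  exists_standard_dual : ∃ (δ : ℕ) (W : Fin (δ + 1) → Submodule K V), IsStandardOrdering As A W
  irreducible : ¬ ∃ W : Submodule K V, W.map A ≤ W ∧ W.map As ≤ W ∧ W ≠ ⊥ ∧ W ≠ ⊤

/-- `E 0, …, E d` is a standard ordering (with respect to `B`) of the primitive idempotents of `A`:
there is a standard ordering `W` of the eigenspaces of `A` such that `E i` is the identity
on `W i` and vanishes on `W j` for `j ≠ i`. -/
def IsStandardIdempotentOrdering (A B : Module.End K V) {d : ℕ}
    (E : Fin (d + 1) → Module.End K V) : Prop :=
  ∃ W : Fin (d + 1) → Submodule K V, IsStandardOrdering A B W ∧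
    (∀ i, ∀ v ∈ W i, E i v = v) ∧ (∀ i j, j ≠ i → ∀ v ∈ W j, E i v = 0)

/-- `(A; {E_i}; As; {Es_i})` is a tridiagonal system on `V` (of diameter `d`). -/
structure IsTridiagonalSystem {d : ℕ} (A : Module.End K V) (E : Fin (d + 1) → Module.End K V)
    (As : Module.End K V) (Es : Fin (d + 1) → Module.End K V) : Prop where
  pair : IsTridiagonalPair A As
  idempotents : IsStandardIdempotentOrdering A As E
  idempotents_dual : IsStandardIdempotentOrdering As A Es

/-- `θ i` is the eigenvalue of `A` associated with the eigenspace `E_i V`, for all `i`. -/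
def IsEigenvalueSequence {d : ℕ} (A : Module.End K V) (E : Fin (d + 1) → Module.End K V)
    (θ : Fin (d + 1) → K) : Prop :=
  ∀ i, LinearMap.range (E i) ≠ ⊥ ∧ LinearMap.range (E i) = A.eigenspace (θ i)

end Pairs

/-- The generators `a`, `e_i`, `a*`, `e*_i`. -/
inductive Gen (d : ℕ) : Type
  | a : Gen d
  | e : Fin (d + 1) → Gen d
  | as : Gen d
  | es : Fin (d + 1) → Gen d

section Algebra

variable {K : Type*} [Field K] {d : ℕ}

/-- The generator `g` in the free algebra. -/
abbrev free (K : Type*) [Field K] {d : ℕ} (g : Gen d) : FreeAlgebra K (Gen d) :=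
  FreeAlgebra.ι K g

/-- The defining relations of the algebra `T`. -/
inductive Rel (θ θs : Fin (d + 1) → K) : FreeAlgebra K (Gen d) → FreeAlgebra K (Gen d) → Prop
  | e_mul_e (i j : Fin (d + 1)) :
      Rel θ θs (free K (.e i) * free K (.e j)) (if i = j then free K (.e i) else 0)
  | es_mul_es (i j : Fin (d + 1)) :
      Rel θ θs (free K (.es i) * free K (.es j)) (if i = j then free K (.es i) else 0)
  | sum_e : Rel θ θs (∑ i, free K (.e i)) 1
  | sum_es : Rel θ θs (∑ i, free K (.es i)) 1
  | a_eq : Rel θ θs (free K .a) (∑ i, θ i • free K (.e i))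
  | as_eq : Rel θ θs (free K .as) (∑ i, θs i • free K (.es i))
  | es_a_es (i j : Fin (d + 1)) (k : ℕ) (hk : k ≤ d) (h : (k : ℤ) < |(i : ℤ) - (j : ℤ)|) :
      Rel θ θs (free K (.es i) * free K .a ^ k * free K (.es j)) 0
  | e_as_e (i j : Fin (d + 1)) (k : ℕ) (hk : k ≤ d) (h : (k : ℤ) < |(i : ℤ) - (j : ℤ)|) :
      Rel θ θs (free K (.e i) * free K .as ^ k * free K (.e j)) 0

/-- The unital associative `K`-algebra `T` defined by the generators and relations above. -/
abbrev T (θ θs : Fin (d + 1) → K) : Type _ := RingQuot (Rel θ θs)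

/-- The image in `T` of a generator. -/
noncomputable def gen (θ θs : Fin (d + 1) → K) (g : Gen d) : T θ θs :=
  RingQuot.mkAlgHom K (Rel θ θs) (free K g)

/-- The subalgebra `D` of `T` generated by `a`. -/
noncomputable def D (θ θs : Fin (d + 1) → K) : Subalgebra K (T θ θs) :=
  Algebra.adjoin K {gen θ θs .a}

/-- The element `e*_0` of `T`. -/
noncomputable def es0 (θ θs : Fin (d + 1) → K) : T θ θs := gen θ θs (.es 0)

/-- The set `e*_0 D e*_0`. -/
def es0Des0 (θ θs : Fin (d + 1) → K) : Set (T θ θs) :=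
  {y | ∃ x ∈ D θ θs, y = es0 θ θs * x * es0 θ θs}

/-- The algebra `e*_0 T e*_0`. Its identity element is `e*_0`, not the `1` of `T`, so inside `T`
it is a non-unital subalgebra. As `e*_0 = e*_0 1 e*_0` lies in `e*_0 D e*_0`, there is no difference
between being generated by `e*_0 D e*_0` with or without the identity `e*_0` adjoined. -/
def es0Tes0 (θ θs : Fin (d + 1) → K) : NonUnitalSubalgebra K (T θ θs) where
  carrier := {y | ∃ x : T θ θs, y = es0 θ θs * x * es0 θ θs}
  zero_mem' := ⟨0, by simp⟩
  add_mem' := by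
    rintro _ _ ⟨x, rfl⟩ ⟨y, rfl⟩
    exact ⟨x + y, by simp [mul_add, add_mul]⟩
  mul_mem' := by
    rintro _ _ ⟨x, rfl⟩ ⟨y, rfl⟩
    exact ⟨x * es0 θ θs * es0 θ θs * y, by simp [mul_assoc]⟩
  smul_mem' := by
    rintro c _ ⟨x, rfl⟩
    exact ⟨c • x, by simp⟩

end Algebra

end TridiagonalSystems

/-!
Write `b, f_i` for `a*, e*_i`. The algebra `T` is generated by `a` and `b`, since by Lagrange
interpolation their idempotents lie in `K[a]` and `K[b]`. Interpolation at only `t` of the nodes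
shows that `K[b]` is spanned by the polynomials of degree `< t` and the `f_j` at the other nodes. As
`f_0 a^k f_j = 0 = f_j a^k f_0` for `k < j`, many of these `f_j` vanish next to `f_0 x` and `x f_0`
when `x` has low degree in `a`.

Commutativity: `f_0 x z y f_0 = f_0 y z x f_0` for `x, y ∈ K[a]`, by induction on the degree of
`z ∈ K[b]`. For `z = b^t`, replacing `z` by a polynomial of smaller degree proves this when `x` or
`y` has degree `< t`. The difference of the two sides at `x = e_r`, `y = e_s` is thus a banded
matrix with zero diagonal which is annihilated by polynomials of degree `< t` from either side, so
it vanishes. Now take `z = f_0`.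

Generation: a word `f_0 x_1 y_1 x_2 ⋯ x_n f_0` with `x_i ∈ K[a]`, `y_i ∈ K[b]` lies in the algebra
generated by `f_0 K[a] f_0`, by induction on its length and then on the degree `t` of one letter.
Since `K[a] b^t K[a]` is spanned by products whose left factor has degree `< t` or whose right
factor has degree `≤ t`, that letter can be pushed to the right end of the word. Next to an end of
the word a letter of degree `≤ t` in `a` lets its neighbour in `K[b]` be replaced by polynomials of
degree `< t` and `f_0`; the latter splits the word into two shorter ones.
-/

open Polynomial

namespace TridiagonalSystems

section PolynomialSpaces

variable (K : Type*) {R : Type*} [Field K] [Ring R] [Algebra K R]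

/-- The subalgebra `K[x]` of polynomials in `x`, as a subspace, so that products of such
spaces are products of subspaces. -/
abbrev poly (x : R) : Submodule K R :=
  Subalgebra.toSubmodule (Algebra.adjoin K {x})

/-- The space of polynomials of degree less than `n` in `x`. -/
def polyLT (x : R) (n : ℕ) : Submodule K R :=
  Submodule.span K ((x ^ ·) '' Set.Iio n)

variable {K}

theorem aeval_mem_poly (x : R) (p : K[X]) : aeval x p ∈ poly K x :=
  aeval_mem_adjoin_singleton K x

theorem exists_aeval_eq_of_mem_poly {x z : R} (hz : z ∈ poly K x) : ∃ p : K[X], aeval x p = z :=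
  (Algebra.adjoin_singleton_eq_range_aeval K x).le hz

theorem polyLT_zero (x : R) : polyLT K x 0 = ⊥ := by
  simp [polyLT]

theorem polyLT_succ (x : R) (n : ℕ) :
    polyLT K x (n + 1) = polyLT K x n ⊔ (K ∙ (x ^ n)) := by
  rw [polyLT, ← Order.succ_eq_add_one, Order.Iio_succ_eq_insert, Set.image_insert_eq,
    Submodule.span_insert, sup_comm, polyLT]

theorem pow_mem_polyLT (x : R) {k n : ℕ} (hk : k < n) : x ^ k ∈ polyLT K x n :=
  Submodule.subset_span ⟨k, hk, rfl⟩

theorem aeval_mem_polyLT (x : R) {p : K[X]} {n : ℕ} (hp : p.degree < n) :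
    aeval x p ∈ polyLT K x n := by
  rw [aeval_eq_sum_range]
  refine Submodule.sum_mem _ fun k _ => ?_
  rcases lt_or_ge k n with hk | hk
  · exact Submodule.smul_mem _ _ (pow_mem_polyLT x hk)
  · rw [coeff_eq_zero_of_degree_lt (hp.trans_le (by exact_mod_cast hk)), zero_smul]
    exact zero_mem _

theorem pow_mem_poly (x : R) (k : ℕ) : x ^ k ∈ poly K x :=
  pow_mem (Algebra.self_mem_adjoin_singleton K x) k

theorem polyLT_le_poly (x : R) (n : ℕ) : polyLT K x n ≤ poly K x :=
  Submodule.span_le.mpr <| Set.image_subset_iff.mpr fun k _ => pow_mem_poly x k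

theorem span_pow_le_poly (x : R) (k : ℕ) : (K ∙ (x ^ k)) ≤ poly K x :=
  Submodule.span_le.mpr <| Set.singleton_subset_iff.mpr (pow_mem_poly x k)

theorem poly_mul_self (x : R) : poly K x * poly K x = poly K x :=
  (Subalgebra.isIdempotentElem_toSubmodule _).eq

end PolynomialSpaces

section SpectralResolution

variable {K R ι : Type*} [Field K] [Ring R] [Algebra K R] [Fintype ι]

/-- `a = ∑ θ_i e_i` with distinct scalars `θ_i` and orthogonal idempotents `e_i` of sum `1`. -/
structure IsSpectralResolution (θ : ι → K) (e : ι → R) (a : R) : Prop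
    extends CompleteOrthogonalIdempotents e where
  injective : Function.Injective θ
  eq_sum : a = ∑ i, θ i • e i

theorem sum_smul_mul_sum_smul {e : ι → R} (he : OrthogonalIdempotents e) (c c' : ι → K) :
    (∑ i, c i • e i) * ∑ i, c' i • e i = ∑ i, (c i * c' i) • e i := by
  classical
  simp [Finset.sum_mul, Finset.mul_sum, he.mul_eq, smul_smul, mul_comm]

namespace IsSpectralResolution

variable {θ : ι → K} {e : ι → R} {a : R}

theorem span_mul_self (h : IsSpectralResolution θ e a) (i : ι) :
    (K ∙ e i) * (K ∙ e i) = K ∙ e i := by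
  rw [Submodule.span_mul_span, Set.singleton_mul_singleton, (h.idem i).eq]

theorem aeval_eq (h : IsSpectralResolution θ e a) (p : K[X]) :
    aeval a p = ∑ i, p.eval (θ i) • e i := by
  induction p using Polynomial.induction_on with
  | C c => simp [← Finset.smul_sum, h.complete, Algebra.algebraMap_eq_smul_one]
  | add p q hp hq => simp only [map_add, hp, hq, eval_add, add_smul, Finset.sum_add_distrib]
  | monomial n c ih =>
    rw [pow_succ, ← mul_assoc, map_mul, ih, aeval_X]
    conv_lhs => rw [h.eq_sum]
    rw [sum_smul_mul_sum_smul h.toOrthogonalIdempotents]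
    simp only [eval_mul, eval_X]

theorem mem_poly (h : IsSpectralResolution θ e a) (i : ι) : e i ∈ poly K a := by
  classical
  have hi : aeval a (Lagrange.basis Finset.univ θ i) = e i := by
    rw [h.aeval_eq, Finset.sum_eq_single i]
    · rw [Lagrange.eval_basis_self h.injective.injOn (Finset.mem_univ i), one_smul]
    · intro j _ hji
      rw [Lagrange.eval_basis_of_ne hji.symm (Finset.mem_univ j), zero_smul]
    · simp
  exact hi ▸ aeval_mem_poly a _

/-- By Lagrange interpolation, every polynomial in `a` agrees with one of degree less than `n`
on the idempotents `e_i`, `i ∈ s`. -/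
theorem poly_le (h : IsSpectralResolution θ e a) {s : Finset ι} {n : ℕ} (hs : s.card ≤ n)
    {N : Submodule K R} (hN : polyLT K a n ≤ N) (he : ∀ i ∉ s, e i ∈ N) : poly K a ≤ N := by
  classical
  intro x hx
  obtain ⟨u, rfl⟩ := exists_aeval_eq_of_mem_poly hx
  set v := Lagrange.interpolate s θ fun i => u.eval (θ i)
  have hdeg : v.degree < n :=
    (Lagrange.degree_interpolate_lt _ h.injective.injOn).trans_le (by exact_mod_cast hs)
  have hsub : aeval a (u - v) ∈ N := by
    rw [h.aeval_eq]
    refine N.sum_mem fun i _ => ?_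
    by_cases hi : i ∈ s
    · rw [eval_sub, Lagrange.eval_interpolate_at_node _ h.injective.injOn hi, sub_self, zero_smul]
      exact zero_mem N
    · exact N.smul_mem _ (he i hi)
  rw [← sub_add_cancel u v, map_add]
  exact N.add_mem hsub (hN (aeval_mem_polyLT a hdeg))

theorem poly_le_span_range (h : IsSpectralResolution θ e a) :
    poly K a ≤ Submodule.span K (Set.range e) :=
  h.poly_le (s := ∅) le_rfl (by simp [polyLT_zero]) fun i _ => Submodule.subset_span ⟨i, rfl⟩

theorem poly_le_polyLT_card (h : IsSpectralResolution θ e a) :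
    poly K a ≤ polyLT K a (Fintype.card ι) :=
  h.poly_le (s := Finset.univ) le_rfl le_rfl fun i hi => absurd (Finset.mem_univ i) hi

variable {d : ℕ} {θ : Fin (d + 1) → K} {e : Fin (d + 1) → R} {a : R}

theorem poly_le_of_interval (h : IsSpectralResolution θ e a) (m n : ℕ) {N : Submodule K R}
    (hN : polyLT K a n ≤ N) (he : ∀ i : Fin (d + 1), (i : ℕ) < m ∨ m + n ≤ i → e i ∈ N) :
    poly K a ≤ N := by
  have hmaps : Set.MapsTo (Fin.val (n := d + 1))
      (Finset.univ.filter fun i : Fin (d + 1) => m ≤ (i : ℕ) ∧ (i : ℕ) < m + n)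
      (Finset.Ico m (m + n)) := fun i hi => by simpa using hi
  refine h.poly_le ?_ hN (s := Finset.univ.filter fun i => m ≤ (i : ℕ) ∧ (i : ℕ) < m + n)
    fun i hi => ?_
  · simpa using Finset.card_le_card_of_injOn _ hmaps Fin.val_injective.injOn
  · simp only [Finset.mem_filter, Finset.mem_univ, true_and] at hi
    exact he i (by omega)

/-- Row and column `i` of the matrix `β (e i) (e j)` are cleared by induction on `i`: the entries
beyond the diagonal follow by interpolation at the nodes `i + 1, …, i + t`, which leaves the
diagonal entry to be assumed. -/
theorem bilin_eq_zero_of_banded (h : IsSpectralResolution θ e a)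
    {M : Type*} [AddCommGroup M] [Module K M] {β : R →ₗ[K] R →ₗ[K] M} {t : ℕ}
    (hband : ∀ i j : Fin (d + 1), (t : ℤ) < |(i : ℤ) - (j : ℤ)| → β (e i) (e j) = 0)
    (hleft : ∀ x ∈ polyLT K a t, ∀ y ∈ poly K a, β x y = 0)
    (hright : ∀ x ∈ poly K a, ∀ y ∈ polyLT K a t, β x y = 0)
    (hdiag : ∀ i, (∀ j < i, β (e i) (e j) = 0) → β (e i) (e i) = 0)
    {x y : R} (hx : x ∈ poly K a) (hy : y ∈ poly K a) : β x y = 0 := by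
  have hcross : ∀ i j, β (e i) (e j) = 0 ∧ β (e j) (e i) = 0 := by
    intro i
    induction i using WellFoundedLT.induction with
    | ind i ih =>
    have hii : β (e i) (e i) = 0 := hdiag i fun j hj => (ih j hj i).2
    have hrow : poly K a ≤ LinearMap.ker (β (e i)) := by
      refine h.poly_le_of_interval (i + 1) t (hright _ (h.mem_poly i)) fun j hj => ?_
      rcases lt_trichotomy j i with hji | rfl | hji
      · exact (ih j hji i).2
      · exact hii
      · exact hband i j (by rw [lt_abs]; omega)
    have hcol : poly K a ≤ LinearMap.ker (β.flip (e i)) := by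
      refine h.poly_le_of_interval (i + 1) t
        (fun x hx => hleft x hx _ (h.mem_poly i)) fun j hj => ?_
      rcases lt_trichotomy j i with hji | rfl | hji
      · exact (ih j hji i).1
      · exact hii
      · exact hband j i (by rw [lt_abs]; omega)
    exact fun j => ⟨hrow (h.mem_poly j), hcol (h.mem_poly j)⟩
  have hspan : ∀ i, poly K a ≤ LinearMap.ker (β (e i)) := fun i =>
    h.poly_le_span_range.trans <| Submodule.span_le.mpr <| Set.range_subset_iff.mpr fun j =>
      (hcross i j).1
  have hspan' : poly K a ≤ LinearMap.ker (β.flip y) :=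
    h.poly_le_span_range.trans <| Submodule.span_le.mpr <| Set.range_subset_iff.mpr fun i =>
      hspan i hy
  exact hspan' hx

end IsSpectralResolution

end SpectralResolution

section Tridiagonal

variable {K R : Type*} [Field K] [Ring R] [Algebra K R] {d : ℕ}

/-- The elements `e_i` see `b` as a tridiagonal matrix: `e_i b^k e_j = 0` for `k < |i - j|`. -/
def IsTridiagonalFor (e : Fin (d + 1) → R) (b : R) : Prop :=
  ∀ (i j : Fin (d + 1)) (k : ℕ), (k : ℤ) < |(i : ℤ) - (j : ℤ)| → e i * b ^ k * e j = 0

/-- The relations of the algebra `T` for elements `a, e_i, b, f_i` of an arbitrary algebra, with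
distinct scalars `θ_i` and distinct scalars `θs_i`. -/
structure IsTridiagonalRelation (θ θs : Fin (d + 1) → K) (e f : Fin (d + 1) → R) (a b : R) :
    Prop where
  resolution : IsSpectralResolution θ e a
  resolution_dual : IsSpectralResolution θs f b
  tridiagonal : IsTridiagonalFor e b
  tridiagonal_dual : IsTridiagonalFor f a

variable {θ θs : Fin (d + 1) → K} {e f : Fin (d + 1) → R} {a b : R}

variable (K) in
/-- The span of the elements `f_n, f_{n+1}, …` of a finite sequence. -/
def tail (f : Fin (d + 1) → R) (n : ℕ) : Submodule K R :=
  Submodule.span K (f '' {i | n ≤ (i : ℕ)})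

theorem IsTridiagonalFor.tail_mul_polyLT_mul (h : IsTridiagonalFor f a) (n : ℕ) :
    tail K f n * polyLT K a n * (K ∙ f 0) = ⊥ := by
  rw [tail, polyLT, Submodule.span_mul_span, Submodule.span_mul_span, Submodule.span_eq_bot]
  rintro _ ⟨_, ⟨_, ⟨i, hi, rfl⟩, _, ⟨k, hk, rfl⟩, rfl⟩, _, rfl, rfl⟩
  exact h i 0 k (by simpa using hk.trans_le hi)

theorem IsTridiagonalFor.mul_polyLT_mul_tail (h : IsTridiagonalFor f a) (n : ℕ) :
    (K ∙ f 0) * polyLT K a n * tail K f n = ⊥ := by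
  rw [tail, polyLT, Submodule.span_mul_span, Submodule.span_mul_span, Submodule.span_eq_bot]
  rintro _ ⟨_, ⟨_, rfl, _, ⟨k, hk, rfl⟩, rfl⟩, _, ⟨i, hi, rfl⟩, rfl⟩
  exact h 0 i k (by simpa using hk.trans_le hi)

theorem IsSpectralResolution.poly_le_polyLT_sup_tail (h : IsSpectralResolution θs f b) (n : ℕ) :
    poly K b ≤ polyLT K b n ⊔ tail K f n :=
  h.poly_le_of_interval 0 n le_sup_left fun i hi =>
    Submodule.mem_sup_right <| Submodule.subset_span ⟨i, by simpa using hi, rfl⟩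

theorem IsSpectralResolution.poly_le_polyLT_sup_span_sup_tail (h : IsSpectralResolution θs f b)
    (n : ℕ) : poly K b ≤ polyLT K b n ⊔ (K ∙ f 0) ⊔ tail K f (n + 1) := by
  refine h.poly_le_of_interval 1 n (le_sup_left.trans le_sup_left) fun i hi => ?_
  rcases hi with hi | hi
  · obtain rfl : i = 0 := Fin.ext (by simpa using hi)
    exact Submodule.mem_sup_left <| Submodule.mem_sup_right <| Submodule.mem_span_singleton_self _
  · exact Submodule.mem_sup_right <| Submodule.subset_span ⟨i, by simpa [add_comm] using hi, rfl⟩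

theorem IsSpectralResolution.poly_mul_span_pow_mul_poly_le (ha : IsSpectralResolution θ e a)
    (hb : IsTridiagonalFor e b) (t : ℕ) :
    poly K a * (K ∙ (b ^ t)) * poly K a ≤
      polyLT K a t * (K ∙ (b ^ t)) * poly K a ⊔
        poly K a * (K ∙ (b ^ t)) * polyLT K a (t + 1) := by
  set N := polyLT K a t * (K ∙ (b ^ t)) * poly K a ⊔
    poly K a * (K ∙ (b ^ t)) * polyLT K a (t + 1)
  have hbt : b ^ t ∈ (K ∙ (b ^ t)) := Submodule.mem_span_singleton_self _
  let β : R →ₗ[K] R →ₗ[K] R ⧸ N :=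
    ((LinearMap.mul K R).compr₂ N.mkQ).comp (LinearMap.mulRight K (b ^ t))
  have hβ : ∀ x y, β x y = 0 ↔ x * b ^ t * y ∈ N := fun x y => Submodule.Quotient.mk_eq_zero N
  have hright : ∀ x ∈ poly K a, ∀ y ∈ polyLT K a (t + 1), β x y = 0 := fun x hx y hy =>
    (hβ x y).mpr <| Submodule.mem_sup_right <|
      Submodule.mul_mem_mul (Submodule.mul_mem_mul hx hbt) hy
  have hband : ∀ i j : Fin (d + 1), (t : ℤ) < |(i : ℤ) - (j : ℤ)| → β (e i) (e j) = 0 :=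
    fun i j hij => (hβ _ _).mpr (by rw [hb i j t hij]; exact zero_mem N)
  have hzero : ∀ x ∈ poly K a, ∀ y ∈ poly K a, β x y = 0 := by
    intro x hx y hy
    refine ha.bilin_eq_zero_of_banded hband ?_ ?_ ?_ hx hy
    · exact fun x hx y hy => (hβ x y).mpr <| Submodule.mem_sup_left <|
        Submodule.mul_mem_mul (Submodule.mul_mem_mul hx hbt) hy
    · exact fun x hx y hy => hright x hx y (polyLT_succ (K := K) a t ▸ Submodule.mem_sup_left hy)
    · intro i hi
      have hker : poly K a ≤ LinearMap.ker (β (e i)) := by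
        refine ha.poly_le_of_interval i (t + 1) (hright _ (ha.mem_poly i)) fun j hj => ?_
        rcases hj with hj | hj
        · exact hi j hj
        · exact hband i j (by rw [lt_abs]; omega)
      exact hker (ha.mem_poly i)
  rw [Submodule.mul_le]
  intro z hz y hy
  obtain ⟨x, hx, rfl⟩ := Submodule.mem_mul_span_singleton.mp hz
  exact (hβ x y).mp (hzero x hx y hy)

theorem IsSpectralResolution.exists_mem_polyLT_mul_eq (hb : IsSpectralResolution θs f b)
    (ha : IsTridiagonalFor f a) {z : R} (hz : z ∈ poly K b) (t : ℕ) :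
    ∃ v ∈ polyLT K b t, ∀ x ∈ polyLT K a t,
      f 0 * x * z = f 0 * x * v ∧ z * (x * f 0) = v * (x * f 0) := by
  obtain ⟨v, hv, w, hw, rfl⟩ :=
    Submodule.mem_sup.mp (hb.poly_le_polyLT_sup_tail t hz)
  have hf := Submodule.mem_span_singleton_self (R := K) (f 0)
  refine ⟨v, hv, fun x hx => ?_⟩
  have hxw : f 0 * x * w = 0 := by
    simpa [ha.mul_polyLT_mul_tail] using
      Submodule.mul_mem_mul (Submodule.mul_mem_mul hf hx) hw
  have hwx : w * (x * f 0) = 0 := by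
    simpa [ha.tail_mul_polyLT_mul, mul_assoc] using
      Submodule.mul_mem_mul (Submodule.mul_mem_mul hw hx) hf
  rw [mul_add, hxw, add_zero, add_mul, hwx, add_zero]
  exact ⟨rfl, rfl⟩

theorem IsSpectralResolution.mul_pow_mul_comm (ha : IsSpectralResolution θ e a)
    (hb : IsTridiagonalFor e b) {c : R} {t : ℕ}
    (ht : ∀ x ∈ polyLT K a t, ∀ y ∈ poly K a,
      c * x * b ^ t * (y * c) = c * y * b ^ t * (x * c))
    {x y : R} (hx : x ∈ poly K a) (hy : y ∈ poly K a) :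
    c * x * b ^ t * (y * c) = c * y * b ^ t * (x * c) := by
  let γ : R →ₗ[K] R →ₗ[K] R := (LinearMap.mul K R).compl₁₂
    (LinearMap.mulLeftRight K (c, b ^ t)) (LinearMap.mulRight K c)
  have hband : ∀ i j : Fin (d + 1), (t : ℤ) < |(i : ℤ) - (j : ℤ)| → γ (e i) (e j) = 0 := by
    intro i j hij
    calc γ (e i) (e j) = c * (e i * b ^ t * e j) * c := by simp [γ, mul_assoc]
      _ = 0 := by rw [hb i j t hij, mul_zero, zero_mul]
  have hβ : (γ - γ.flip) x y = 0 := by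
    refine ha.bilin_eq_zero_of_banded (t := t) (fun i j hij => ?_) ?_ ?_ (fun i _ => ?_) hx hy
    · simp [hband i j hij, hband j i (by rwa [abs_sub_comm])]
    · exact fun x hx y hy => sub_eq_zero.mpr (ht x hx y hy)
    · exact fun x hx y hy => sub_eq_zero.mpr (ht y hy x hx).symm
    · exact sub_self _
  exact sub_eq_zero.mp hβ

namespace IsTridiagonalRelation

protected theorem symm (h : IsTridiagonalRelation θ θs e f a b) :
    IsTridiagonalRelation θs θ f e b a :=
  ⟨h.resolution_dual, h.resolution, h.tridiagonal_dual, h.tridiagonal⟩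

theorem mul_mul_mul_comm_of_mem_polyLT (h : IsTridiagonalRelation θ θs e f a b) {t : ℕ} :
    ∀ z ∈ polyLT K b t, ∀ x ∈ poly K a, ∀ y ∈ poly K a,
      f 0 * x * z * (y * f 0) = f 0 * y * z * (x * f 0) := by
  induction t with
  | zero =>
    intro z hz x _ y _
    obtain rfl : z = 0 := by simpa [polyLT_zero] using hz
    simp
  | succ t ih =>
    have hpow : ∀ x ∈ poly K a, ∀ y ∈ poly K a,
        f 0 * x * b ^ t * (y * f 0) = f 0 * y * b ^ t * (x * f 0) := by
      obtain ⟨v, hv, hbv⟩ := h.resolution_dual.exists_mem_polyLT_mul_eq h.tridiagonal_dual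
        (pow_mem_poly b t) t
      refine fun _ hx _ hy =>
        h.resolution.mul_pow_mul_comm h.tridiagonal (fun x hx y hy => ?_) hx hy
      rw [(hbv x hx).1, ih v hv x (polyLT_le_poly a t hx) y hy, mul_assoc _ v, ← (hbv x hx).2,
        mul_assoc _ (b ^ t)]
    intro z hz x hx y hy
    rw [polyLT_succ] at hz
    obtain ⟨v, hv, w, hw, rfl⟩ := Submodule.mem_sup.mp hz
    obtain ⟨c, rfl⟩ := Submodule.mem_span_singleton.mp hw
    simp only [mul_add, add_mul, mul_smul_comm, smul_mul_assoc, ih v hv x hx y hy,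
      hpow x hx y hy]

theorem corner_commute (h : IsTridiagonalRelation θ θs e f a b) {x y : R} (hx : x ∈ poly K a)
    (hy : y ∈ poly K a) : Commute (f 0 * x * f 0) (f 0 * y * f 0) := by
  have hmul : ∀ x y, f 0 * x * f 0 * (f 0 * y * f 0) = f 0 * x * f 0 * (y * f 0) := fun x y => by
    simp only [← mul_assoc, mul_assoc _ (f 0) (f 0), (h.resolution_dual.idem 0).eq]
  rw [Commute, SemiconjBy, hmul, hmul]
  exact h.mul_mul_mul_comm_of_mem_polyLT _
    (h.resolution_dual.poly_le_polyLT_card (h.resolution_dual.mem_poly 0)) x hx y hy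

end IsTridiagonalRelation

end Tridiagonal

section Words

/-- The alternating sequence `a, b, a, b, …`. -/
def letter {R : Type*} (a b : R) : ℕ → R
  | 0 => a
  | n + 1 => letter b a n

theorem letter_two_mul {R : Type*} (a b : R) (n : ℕ) : letter a b (2 * n) = a := by
  induction n with
  | zero => rfl
  | succ _ ih => exact ih

variable (K : Type*) {R : Type*} [Field K] [Ring R] [Algebra K R]

/-- The product `K[a] K[b] K[a] ⋯` of `n` alternating factors. -/
def word (a b : R) : ℕ → Submodule K R
  | 0 => 1
  | n + 1 => poly K a * word b a n

variable {K}

theorem word_succ (a b : R) (n : ℕ) : word K a b (n + 1) = poly K a * word K b a n :=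
  rfl

theorem word_one (a b : R) : word K a b 1 = poly K a := by
  rw [word_succ, word, mul_one]

theorem word_add (a b : R) (m n : ℕ) :
    word K a b (m + n) = word K a b m * word K (letter a b m) (letter a b (m + 1)) n := by
  induction m generalizing a b with
  | zero => simp [word, letter]
  | succ m ih => rw [Nat.add_right_comm, word, ih, ← mul_assoc]; rfl

theorem word_succ' (a b : R) (n : ℕ) :
    word K a b (n + 1) = word K a b n * poly K (letter a b n) := by
  rw [word_add, word_one]

theorem iSup_word_eq_top {a b : R} (hab : Algebra.adjoin K {a, b} = ⊤) :
    ⨆ n, word K a b (2 * n + 1) = ⊤ := by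
  set N := ⨆ n, word K a b (2 * n + 1) with hN
  have hone (x : R) : 1 ≤ poly K x := Submodule.one_le.mpr (one_mem (Algebra.adjoin K {x}))
  have hle (n : ℕ) : word K a b (2 * n + 1) ≤ N := le_iSup (fun n => word K a b (2 * n + 1)) n
  have ha : poly K a * N ≤ N := by
    rw [hN, Submodule.mul_iSup]
    refine iSup_mono fun n => ?_
    rw [word, ← mul_assoc, poly_mul_self]
  have hb : poly K b * N ≤ N := by
    nth_rw 1 [hN]
    rw [Submodule.mul_iSup]
    exact iSup_le fun n => (le_mul_of_one_le_left' (hone a)).trans (hle (n + 1))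
  rw [eq_top_iff, ← Algebra.top_toSubmodule, ← hab, Algebra.adjoin_eq_span, Submodule.span_le]
  intro x hx
  induction hx using Submonoid.closure_induction_left with
  | one => exact hle 0 (by simp [word])
  | mul_left x hx y _ ih =>
    have hself (x : R) : x ∈ poly K x := Algebra.self_mem_adjoin_singleton K x
    rcases hx with rfl | rfl
    · exact ha (Submodule.mul_mem_mul (hself x) ih)
    · exact hb (Submodule.mul_mem_mul (hself x) ih)

end Words

section Generation

variable {K R : Type*} [Field K] [Ring R] [Algebra K R] {d : ℕ}
  {θ θs : Fin (d + 1) → K} {e f : Fin (d + 1) → R} {a b : R} {S : Submodule K R}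

theorem IsSpectralResolution.mul_poly_mul_polyLT_mul_le (hf : IsSpectralResolution θs f b)
    (hfa : IsTridiagonalFor f a) (hS : S * S ≤ S)
    {L : Submodule K R} {t : ℕ} (ha : (K ∙ f 0) * poly K a * (K ∙ f 0) ≤ S)
    (hL : (K ∙ f 0) * L * (K ∙ f 0) ≤ S)
    (hLt : (K ∙ f 0) * L * polyLT K b t * (poly K a * (K ∙ f 0)) ≤ S) :
    (K ∙ f 0) * (L * poly K b) * polyLT K a (t + 1) * (K ∙ f 0) ≤ S := by
  have hidem := hf.span_mul_self 0
  set F := K ∙ f 0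
  set P := polyLT K a (t + 1)
  have hP : P ≤ poly K a := polyLT_le_poly a _
  calc F * (L * poly K b) * P * F
      ≤ F * (L * (polyLT K b t ⊔ F ⊔ tail K f (t + 1))) * P * F := by
        gcongr
        exact hf.poly_le_polyLT_sup_span_sup_tail t
    _ = F * L * polyLT K b t * (P * F) ⊔ F * L * F * (F * P * F) ⊔
          F * L * (tail K f (t + 1) * P * F) := by
        simp only [Submodule.mul_sup, Submodule.sup_mul, mul_assoc]
        rw [← mul_assoc F F, hidem]
    _ ≤ S := by
        rw [hfa.tail_mul_polyLT_mul, Submodule.mul_bot, sup_bot_eq]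
        exact sup_le (le_trans (by gcongr) hLt)
          (le_trans (mul_le_mul' hL (le_trans (by gcongr) ha)) hS)

theorem IsSpectralResolution.mul_polyLT_mul_poly_mul_le (hf : IsSpectralResolution θs f b)
    (hfa : IsTridiagonalFor f a) (hS : S * S ≤ S)
    {L : Submodule K R} {t : ℕ} (ha : (K ∙ f 0) * poly K a * (K ∙ f 0) ≤ S)
    (hL : (K ∙ f 0) * L * (K ∙ f 0) ≤ S)
    (hLt : (K ∙ f 0) * poly K a * polyLT K b t * (L * (K ∙ f 0)) ≤ S) :
    (K ∙ f 0) * polyLT K a (t + 1) * (poly K b * L * (K ∙ f 0)) ≤ S := by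
  have hidem := hf.span_mul_self 0
  set F := K ∙ f 0
  set P := polyLT K a (t + 1)
  have hP : P ≤ poly K a := polyLT_le_poly a _
  calc F * P * (poly K b * L * F)
      ≤ F * P * ((polyLT K b t ⊔ F ⊔ tail K f (t + 1)) * L * F) := by
        gcongr
        exact hf.poly_le_polyLT_sup_span_sup_tail t
    _ = F * P * polyLT K b t * (L * F) ⊔ F * P * F * (F * L * F) ⊔
          F * P * tail K f (t + 1) * (L * F) := by
        simp only [Submodule.mul_sup, Submodule.sup_mul, mul_assoc]
        rw [← mul_assoc F F, hidem]
    _ ≤ S := by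
        rw [hfa.mul_polyLT_mul_tail, Submodule.bot_mul, sup_bot_eq]
        exact sup_le (le_trans (by gcongr) hLt)
          (le_trans (mul_le_mul' (le_trans (by gcongr) ha) hL) hS)

/-- The factor of bounded degree moves two places to the right in a word, at the cost of terms in
which its degree is smaller. -/
theorem IsSpectralResolution.mul_polyLT_succ_mul_le (he : IsSpectralResolution θ e a)
    (heb : IsTridiagonalFor e b) {L M : Submodule K R}
    {t : ℕ} (hb : L * poly K a * polyLT K b t * (poly K a * M) ≤ S)
    (hleft : L * polyLT K a t * (poly K b * (poly K a * M)) ≤ S)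
    (hright : L * poly K a * poly K b * polyLT K a (t + 1) * M ≤ S) :
    L * poly K a * polyLT K b (t + 1) * (poly K a * M) ≤ S := by
  have hbt : (K ∙ (b ^ t)) ≤ poly K b := span_pow_le_poly b t
  rw [polyLT_succ, Submodule.mul_sup, Submodule.sup_mul]
  refine sup_le hb ?_
  calc L * poly K a * (K ∙ (b ^ t)) * (poly K a * M)
      = L * (poly K a * (K ∙ (b ^ t)) * poly K a) * M := by simp only [mul_assoc]
    _ ≤ L * (polyLT K a t * (K ∙ (b ^ t)) * poly K a ⊔
          poly K a * (K ∙ (b ^ t)) * polyLT K a (t + 1)) * M := by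
        gcongr
        exact he.poly_mul_span_pow_mul_poly_le heb t
    _ = L * polyLT K a t * ((K ∙ (b ^ t)) * (poly K a * M)) ⊔
          L * poly K a * (K ∙ (b ^ t)) * polyLT K a (t + 1) * M := by
        simp only [Submodule.mul_sup, Submodule.sup_mul, mul_assoc]
    _ ≤ S := sup_le (le_trans (by gcongr) hleft) (le_trans (by gcongr) hright)

namespace IsTridiagonalRelation

theorem exists_relation_letter (h : IsTridiagonalRelation θ θs e f a b) (n : ℕ) :
    ∃ (θ' θs' : Fin (d + 1) → K) (e' f' : Fin (d + 1) → R),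
      IsTridiagonalRelation θ' θs' e' f' (letter a b n) (letter a b (n + 1)) := by
  induction n generalizing θ θs e f a b with
  | zero => exact ⟨θ, θs, e, f, h⟩
  | succ _ ih => exact ih h.symm

theorem word_mul_polyLT_mul_word_le (h : IsTridiagonalRelation θ θs e f a b) (hS : S * S ≤ S)
    (ha : (K ∙ f 0) * poly K a * (K ∙ f 0) ≤ S) {n : ℕ}
    (hword : (K ∙ f 0) * word K a b (2 * n + 1) * (K ∙ f 0) ≤ S) (t : ℕ) :
    ∀ j i, i + 1 + j = 2 * n + 3 →
      (K ∙ f 0) * word K a b i * polyLT K (letter a b i) t *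
        (word K (letter a b (i + 1)) (letter a b (i + 2)) j * (K ∙ f 0)) ≤ S := by
  induction t with
  | zero => simp [polyLT_zero]
  | succ t iht =>
    intro j
    induction j with
    | zero =>
      intro i hi
      obtain rfl : i = 2 * n + 2 := by omega
      have hodd : letter a b (2 * n + 1) = b := letter_two_mul b a n
      have heven : letter a b (2 * n + 2) = a := letter_two_mul a b (n + 1)
      have ht := iht 1 (2 * n + 1) (by omega)
      rw [hodd, heven, word_one] at ht
      rw [word_succ', hodd, heven, word, one_mul]
      exact h.resolution_dual.mul_poly_mul_polyLT_mul_le h.tridiagonal_dual hS ha hword ht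
    | succ j ihj =>
      intro i hi
      cases i with
      | zero =>
        obtain rfl : j = 2 * n + 1 := by omega
        have ht := iht (2 * n + 1) 1 (by omega)
        rw [word_one] at ht
        rw [word, mul_one, word_succ]
        exact h.resolution_dual.mul_polyLT_mul_poly_mul_le h.tridiagonal_dual hS ha hword ht
      | succ i =>
        obtain ⟨θ', θs', e', f', h'⟩ := h.exists_relation_letter i
        have hmid := iht (j + 1) (i + 1) (by omega)
        have hleft := iht (j + 2) i (by omega)
        have hright := ihj (i + 2) (by omega)
        rw [word_succ', word_succ, ← mul_assoc (K ∙ _), mul_assoc (poly K _)] at hmid ⊢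
        rw [word_succ, word_succ, mul_assoc (poly K _), mul_assoc (poly K _)] at hleft
        rw [word_succ', word_succ', ← mul_assoc (K ∙ _), ← mul_assoc (K ∙ _)] at hright
        exact h'.resolution.mul_polyLT_succ_mul_le h'.tridiagonal hmid hleft hright

theorem word_le (h : IsTridiagonalRelation θ θs e f a b) (hS : S * S ≤ S)
    (ha : (K ∙ f 0) * poly K a * (K ∙ f 0) ≤ S) (n : ℕ) :
    (K ∙ f 0) * word K a b (2 * n + 1) * (K ∙ f 0) ≤ S := by
  induction n with
  | zero => simpa [word] using ha
  | succ n ih =>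
    have hpoly : poly K a ≤ polyLT K a (d + 1) := by
      simpa using h.resolution.poly_le_polyLT_card
    calc (K ∙ f 0) * word K a b (2 * (n + 1) + 1) * (K ∙ f 0)
        = (K ∙ f 0) * word K a b 0 * poly K a * (word K b a (2 * n + 2) * (K ∙ f 0)) := by
          rw [word_succ, word, mul_one]
          simp only [mul_assoc, mul_add_one]
      _ ≤ (K ∙ f 0) * word K a b 0 * polyLT K a (d + 1) *
            (word K b a (2 * n + 2) * (K ∙ f 0)) := by gcongr
      _ ≤ S := h.word_mul_polyLT_mul_word_le hS ha ih (d + 1) (2 * n + 2) 0 (by omega)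

theorem span_mul_top_mul_span_le (h : IsTridiagonalRelation θ θs e f a b)
    (hab : Algebra.adjoin K {a, b} = ⊤) (hS : S * S ≤ S)
    (ha : (K ∙ f 0) * poly K a * (K ∙ f 0) ≤ S) :
    (K ∙ f 0) * ⊤ * (K ∙ f 0) ≤ S := by
  rw [← iSup_word_eq_top hab, Submodule.mul_iSup, Submodule.iSup_mul]
  exact iSup_le (h.word_le hS ha)

end IsTridiagonalRelation

end Generation

section Presentation

variable {K : Type*} [Field K] {d : ℕ} {θ θs : Fin (d + 1) → K}

theorem isTridiagonalRelation_gen (hθ : Function.Injective θ) (hθs : Function.Injective θs) :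
    IsTridiagonalRelation θ θs (fun i => gen θ θs (.e i)) (fun i => gen θ θs (.es i))
      (gen θ θs .a) (gen θ θs .as) where
  resolution :=
    { toOrthogonalIdempotents := OrthogonalIdempotents.iff_mul_eq.mpr fun i j => by
        simpa [gen, apply_ite] using RingQuot.mkAlgHom_rel K (Rel.e_mul_e (θ := θ) (θs := θs) i j)
      complete := by
        simpa [gen] using RingQuot.mkAlgHom_rel K (Rel.sum_e (θ := θ) (θs := θs))
      injective := hθ
      eq_sum := by simpa [gen] using RingQuot.mkAlgHom_rel K (Rel.a_eq (θ := θ) (θs := θs)) }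
  resolution_dual :=
    { toOrthogonalIdempotents := OrthogonalIdempotents.iff_mul_eq.mpr fun i j => by
        simpa [gen, apply_ite] using RingQuot.mkAlgHom_rel K (Rel.es_mul_es (θ := θ) (θs := θs) i j)
      complete := by
        simpa [gen] using RingQuot.mkAlgHom_rel K (Rel.sum_es (θ := θ) (θs := θs))
      injective := hθs
      eq_sum := by simpa [gen] using RingQuot.mkAlgHom_rel K (Rel.as_eq (θ := θ) (θs := θs)) }
  tridiagonal i j k hk := by
    simpa [gen] using RingQuot.mkAlgHom_rel K
      (Rel.e_as_e (θ := θ) (θs := θs) i j k (by rw [lt_abs] at hk; omega) hk)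
  tridiagonal_dual i j k hk := by
    simpa [gen] using RingQuot.mkAlgHom_rel K
      (Rel.es_a_es (θ := θ) (θs := θs) i j k (by rw [lt_abs] at hk; omega) hk)

theorem adjoin_gen_eq_top (hθ : Function.Injective θ) (hθs : Function.Injective θs) :
    Algebra.adjoin K {gen θ θs .a, gen θ θs .as} = ⊤ := by
  have h := isTridiagonalRelation_gen hθ hθs
  set B := Algebra.adjoin K {gen θ θs .a, gen θ θs .as}
  have ha : Algebra.adjoin K {gen θ θs .a} ≤ B := Algebra.adjoin_mono (by simp)
  have has : Algebra.adjoin K {gen θ θs .as} ≤ B := Algebra.adjoin_mono (by simp)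
  have hgen (g : Gen d) : gen θ θs g ∈ B := by
    cases g with
    | a => exact ha (Algebra.self_mem_adjoin_singleton K _)
    | e i => exact ha (h.resolution.mem_poly i)
    | as => exact has (Algebra.self_mem_adjoin_singleton K _)
    | es i => exact has (h.resolution_dual.mem_poly i)
  rw [eq_top_iff, ← (AlgHom.range_eq_top _).mpr (RingQuot.mkAlgHom_surjective K (Rel θ θs)),
    ← Algebra.map_top, ← FreeAlgebra.adjoin_range_ι, AlgHom.map_adjoin, Algebra.adjoin_le_iff]
  rintro _ ⟨_, ⟨g, rfl⟩, rfl⟩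
  exact hgen g

theorem adjoin_es0Des0_eq (hθ : Function.Injective θ) (hθs : Function.Injective θs) :
    NonUnitalAlgebra.adjoin K (es0Des0 θ θs) = es0Tes0 θ θs := by
  refine le_antisymm (NonUnitalAlgebra.adjoin_le ?_) ?_
  · rintro _ ⟨x, -, rfl⟩
    exact ⟨x, rfl⟩
  rintro _ ⟨x, rfl⟩
  set S := NonUnitalAlgebra.adjoin K (es0Des0 θ θs)
  have hS : S.toSubmodule * S.toSubmodule ≤ S.toSubmodule :=
    Submodule.mul_le.mpr fun _ hx _ hy => S.mul_mem' hx hy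
  have hD : (K ∙ es0 θ θs) * poly K (gen θ θs .a) * (K ∙ es0 θ θs) ≤ S.toSubmodule := by
    intro z hz
    obtain ⟨y, hy, rfl⟩ := Submodule.mem_mul_span_singleton.mp hz
    obtain ⟨x, hx, rfl⟩ := Submodule.mem_span_singleton_mul.mp hy
    exact NonUnitalAlgebra.subset_adjoin K ⟨x, hx, rfl⟩
  have hes : es0 θ θs ∈ K ∙ es0 θ θs := Submodule.mem_span_singleton_self _
  exact (isTridiagonalRelation_gen hθ hθs).span_mul_top_mul_span_le (adjoin_gen_eq_top hθ hθs)
    hS hD (Submodule.mul_mem_mul (Submodule.mul_mem_mul hes trivial) hes)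

theorem mul_comm_of_mem_es0Des0 (hθ : Function.Injective θ) (hθs : Function.Injective θs) :
    ∀ x ∈ es0Des0 θ θs, ∀ y ∈ es0Des0 θ θs, x * y = y * x := by
  rintro _ ⟨x, hx, rfl⟩ _ ⟨y, hy, rfl⟩
  exact (isTridiagonalRelation_gen hθ hθs).corner_commute hx hy

end Presentation

section Eigenvalues

variable {K V : Type*} [Field K] [AddCommGroup V] [Module K V] {d : ℕ}

theorem IsEigenvalueSequence.injective {A B : Module.End K V} {E : Fin (d + 1) → Module.End K V}
    {θ : Fin (d + 1) → K} (hθ : IsEigenvalueSequence A E θ)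
    (hE : IsStandardIdempotentOrdering A B E) : Function.Injective θ := by
  obtain ⟨W, ⟨⟨hinj, hrange⟩, -⟩, hid, -⟩ := hE
  have hW (i) : W i = A.eigenspace (θ i) := by
    obtain ⟨hne, η, hη⟩ : IsEigenspace A (W i) := hrange.le ⟨i, rfl⟩
    obtain ⟨v, hv, hv0⟩ := (W i).exists_mem_ne_zero_of_ne_bot hne
    have hθv : v ∈ A.eigenspace (θ i) := (hθ i).2 ▸ ⟨v, hid i v hv⟩
    rw [hη] at hv ⊢
    rw [Module.End.mem_eigenspace_iff] at hv hθv
    rw [smul_left_injective K hv0 (hv.symm.trans hθv)]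
  exact fun i j hij => hinj (by rw [hW, hW, hij])

end Eigenvalues

end TridiagonalSystems

open TridiagonalSystems in
theorem theorem2p6_general {K : Type*} [Field K] {d : ℕ} {θ θs : Fin (d + 1) → K}
    (hθ : Function.Injective θ) (hθs : Function.Injective θs) :
    NonUnitalAlgebra.adjoin K (es0Des0 θ θs) = es0Tes0 θ θs ∧
    (∀ x ∈ es0Des0 θ θs, ∀ y ∈ es0Des0 θ θs, x * y = y * x) ∧
    (∀ x ∈ es0Tes0 θ θs, ∀ y ∈ es0Tes0 θ θs, x * y = y * x) := by
  have hcomm := mul_comm_of_mem_es0Des0 hθ hθs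
  refine ⟨adjoin_es0Des0_eq hθ hθs, hcomm, fun x hx y hy => ?_⟩
  rw [← adjoin_es0Des0_eq hθ hθs] at hx hy
  exact Set.centralizer_centralizer_comm_of_comm hcomm x
    (NonUnitalAlgebra.adjoin_le_centralizer_centralizer K _ hx) y
    (NonUnitalAlgebra.adjoin_le_centralizer_centralizer K _ hy)

open TridiagonalSystems in
theorem theorem2p6 {K V : Type*} [Field K] [AddCommGroup V] [Module K V]
    [FiniteDimensional K V] [Nontrivial V] {d : ℕ}
    (A : Module.End K V) (E : Fin (d + 1) → Module.End K V)
    (As : Module.End K V) (Es : Fin (d + 1) → Module.End K V)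
    (hΦ : IsTridiagonalSystem A E As Es)
    (θ θs : Fin (d + 1) → K)
    (hθ : IsEigenvalueSequence A E θ) (hθs : IsEigenvalueSequence As Es θs) :
    NonUnitalAlgebra.adjoin K (es0Des0 θ θs) = es0Tes0 θ θs ∧
    (∀ x ∈ es0Des0 θ θs, ∀ y ∈ es0Des0 θ θs, x * y = y * x) ∧
    (∀ x ∈ es0Tes0 θ θs, ∀ y ∈ es0Tes0 θ θs, x * y = y * x) :=
  theorem2p6_general (hθ.injective hΦ.idempotents) (hθs.injective hΦ.idempotents_dual)
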